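/- Let $\mathbf{Prof}$ be the bicategory whose 0-cells are small categories, whose 1-cells $\mathcal N\to\mathcal K$ are profunctors $p\colon\mathcal N^{op}\times\mathcal K\to\mathbf{Set}$, whose 2-cells are natural transformations, with composition $(p\diamond p')\langle n,k\rangle=\int^{m}p\langle n,m\rangle\times p'\langle m,k\rangle$ and with the hom-functors as units. For $p\colon\mathcal N^{op}\times\mathcal K\to\mathbf{Set}$ and $a\colon\mathcal N\to\mathbf{Set}$ put $(p\bullet a)(k)=\int^{n\in\mathcal N}a(n)\times p\langle n,k\rangle$. For a bicategory $\mathbb M$, pseudofunctors $F,G\colon\mathbb M\to\mathbf{Cat}$, 0-cells $i,j$ of $\mathbb M$, and objects $a\in Fi$, $b\in Gi$, $s\in Fj$, $t\in Gj$, the compound optic is $$\mathcal O_{i,j}\langle a,b\rangle\langle s,t\rangle=\int^{m\in\mathbb M(i,j)}\bigl(\mathrm{Lan}_{\langle m,m\rangle\bullet}\,\mathcal Y_{\langle a,b\rangle}\bigr)\langle s,t\rangle,$$ where $\langle m,m'\rangle\bullet\langle c,d\rangle=\langle (Fm)c,(Gm')d\rangle$ as a functor $(Fi)^{op}\times Gi\to(Fj)^{op}\times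 Gj$, and $\mathcal Y_{\langle a,b\rangle}\langle c,d\rangle=(Fi)(c,a)\times(Gi)(b,d)$. 1. There is a pseudofunctor $E\colon\mathbf{Prof}\to\mathbf{Cat}$ that sends $\mathcal N$ to $[\mathcal N,\mathbf{Set}]$, a profunctor $p$ to the functor $a\mapsto p\bullet a$, and a 2-cell to the induced natural transformation. Its composition constraint is the Fubini isomorphism $\int^{n}a(n)\times\int^{m}p\langle n,m\rangle\times p'\langle m,k\rangle\cong\int^{m}\bigl(\int^n a(n)\times p\langle n,m\rangle\bigr)\times p'\langle m,k\rangle$, $[n,x,[m,y,z]]\mapsto[m,[n,x,y],z]$, and its unit constraint is the co-Yoneda isomorphism $\int^n a(n)\times\mathcal N(n,k)\cong a(k)$, $[n,x,f]\mapsto a(f)(x)$. 2. For small categories $\mathcal N,\mathcal K$, co-presheaves $a,b\colon\mathcal N\to\mathbf{Set}$ and $s,t\colon\mathcal K\to\mathbf{Set}$, the compound optic obtained by taking $F=G=E$ is $$\mathcal O_{\mathcal N,\mathcal K}\langle a,b\rangle\langle s,t\rangle\;\cong\;\int^{p\colon\mathcal N^{op}\times\mathcal K\to\mathbf{Set}}[\mathcal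 K,\mathbf{Set}]\Bigl(s,\int^{n}a(n)\times p\langle n,-\rangle\Bigr)\times[\mathcal K,\mathbf{Set}]\Bigl(\int^{n'}b(n')\times p\langle n',-\rangle,t\Bigr),$$ the class of $(p,f,g)$ on the right corresponding to the class, in the summand of $p$, of the element that the Kan extension along $\langle p,p\rangle\bullet$ assigns to the morphism $\langle f,g\rangle\colon\langle p,p\rangle\bullet\langle a,b\rangle\to\langle s,t\rangle$. 3. Let $\mathcal N=N$ and $\mathcal K=K$ be discrete (sets), so that $a,b$ and $s,t$ are families of sets $(a_n),(b_n)_{n\in N}$ and $(s_k),(t_k)_{k\in K}$. Then the inner coends are coproducts, $(p\bullet a)(k)\cong\sum_{n\in N}a_n\times p\langle n,k\rangle$, sets of natural transformations of co-presheaves on $K$ are products over $k\in K$ of sets of functions, and through these identifications the compound optic of part 2 is the ommatidia coend over families of sets $c=(c_{nk})_{n\in N,k\in K}$, $$\int^{c}\prod_{k\in K}\mathbf{Set}\Bigl(s_k,\sum_{n\in N}a_n\times c_{nk}\Bigr)\times\prod_{i\in K}\mathbf{Set}\Bigl(\sum_{m\in N}b_m\times c_{mi},t_i\Bigr).$$ This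 coend is in bijection with $$\mathbf{PolyLens}\langle s,t\rangle\langle a,b\rangle=\prod_{k\in K}\mathbf{Set}\Bigl(s_k,\sum_{n\in N}a_n\times\mathbf{Set}(b_n,t_k)\Bigr),$$ the class of $(c,f,g)$ going to $k,x\mapsto(n,u,\,y\mapsto g_k(n,y,v))$ with $(n,u,v)=f_k(x)$; and $\mathbf{PolyLens}\langle s,t\rangle\langle a,b\rangle$ is in bijection, by $\tau\mapsto(k,x\mapsto\tau_{t_k}(k,x,\mathrm{id}))$, with the natural transformations $P\to Q$ of polynomial functors $\mathbf{Set}\to\mathbf{Set}$, where $P(y)=\sum_{k\in K}s_k\times\mathbf{Set}(t_k,y)$ and $Q(y)=\sum_{n\in N}a_n\times\mathbf{Set}(b_n,y)$. -/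

import Mathlib

open CategoryTheory Opposite Bicategory

universe w v u w₁ v₁ u₁

namespace CompoundOptics

open Limits.Types (coend coend.ι coendRel)

/-! ### The coend `∫^m X(m) × Y(m)` -/

section Tensor

variable {M : Type u} [SmallCategory M]

/-- The integrand `(m', m) ↦ X(m) × Y(m')`. -/
def tensorDiagram (X : M ⥤ Type u) (Y : Mᵒᵖ ⥤ Type u) :
    Mᵒᵖ ⥤ M ⥤ Type u where
  obj m' :=
    { obj := fun m => X.obj m × Y.obj m'
      map := fun f => TypeCat.ofHom (Prod.map (X.map f) id) }
  map g := { app := fun _ => TypeCat.ofHom (Prod.map id (Y.map g)) }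

/-- The coend `∫^m X(m) × Y(m)`. -/
abbrev Tensor (X : M ⥤ Type u) (Y : Mᵒᵖ ⥤ Type u) : Type u :=
  coend.{u, u, u} (tensorDiagram X Y)

/-- The class of `(x, y) ∈ X(m) × Y(m)` in `∫^m X(m) × Y(m)`. -/
def Tensor.mk {X : M ⥤ Type u} {Y : Mᵒᵖ ⥤ Type u} (m : M) (x : X.obj m) (y : Y.obj (op m)) :
    Tensor X Y :=
  Quot.mk _ ⟨m, (x, y)⟩

theorem Tensor.sound {X : M ⥤ Type u} {Y : Mᵒᵖ ⥤ Type u} {m m' : M} (f : m ⟶ m')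
    (x : X.obj m) (y : Y.obj (op m')) :
    (Tensor.mk m x (Y.map f.op y) : Tensor X Y) = Tensor.mk m' (X.map f x) y :=
  Quot.sound (coendRel.mk.{u, u, u} (F := tensorDiagram X Y) f (x, y))

/-- Maps out of `∫^m X(m) × Y(m)`. -/
def Tensor.lift {X : M ⥤ Type u} {Y : Mᵒᵖ ⥤ Type u} {Z : Type w}
    (φ : ∀ m, X.obj m → Y.obj (op m) → Z)
    (h : ∀ {m m' : M} (f : m ⟶ m') (x : X.obj m) (y : Y.obj (op m')),
      φ m x (Y.map f.op y) = φ m' (X.map f x) y) : Tensor X Y → Z :=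
  Quot.lift (fun z => φ z.1 z.2.1 z.2.2) (by
    rintro _ _ ⟨f, x⟩
    exact h f x.1 x.2)

theorem Tensor.ind {X : M ⥤ Type u} {Y : Mᵒᵖ ⥤ Type u} {P : Tensor X Y → Prop}
    (h : ∀ m x y, P (Tensor.mk m x y)) (z : Tensor X Y) : P z := by
  obtain ⟨m, x, y⟩ := z
  exact h m x y

/-- Functoriality of `∫^m X(m) × Y(m)` in `X` and `Y`. -/
def Tensor.map {X X' : M ⥤ Type u} {Y Y' : Mᵒᵖ ⥤ Type u} (α : X ⟶ X') (β : Y ⟶ Y') :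
    Tensor X Y → Tensor X' Y' :=
  Tensor.lift (fun m x y => Tensor.mk m (α.app m x) (β.app (op m) y)) (by
    intro m m' f x y
    rw [NatTrans.naturality_apply, NatTrans.naturality_apply, Tensor.sound])

@[simp]
theorem Tensor.lift_mk {X : M ⥤ Type u} {Y : Mᵒᵖ ⥤ Type u} {Z : Type w}
    (φ : ∀ m, X.obj m → Y.obj (op m) → Z)
    (h : ∀ {m m' : M} (f : m ⟶ m') (x : X.obj m) (y : Y.obj (op m')),
      φ m x (Y.map f.op y) = φ m' (X.map f x) y) (m : M) (x : X.obj m) (y : Y.obj (op m)) :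
    Tensor.lift φ h (Tensor.mk m x y) = φ m x y :=
  rfl

@[simp]
theorem Tensor.map_mk {X X' : M ⥤ Type u} {Y Y' : Mᵒᵖ ⥤ Type u} (α : X ⟶ X') (β : Y ⟶ Y')
    (m : M) (x : X.obj m) (y : Y.obj (op m)) :
    Tensor.map α β (Tensor.mk m x y) = Tensor.mk m (α.app m x) (β.app (op m) y) :=
  rfl

end Tensor

/-! ### The action of a profunctor on co-presheaves -/

section Action

variable {N K L : Type u} [SmallCategory N] [SmallCategory K] [SmallCategory L]

/-- The action of a profunctor `p : Nᵒᵖ × K → Set` (in curried form) on co-presheaves: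
`(p • a)(k) = ∫^n a(n) × p⟨n, k⟩`. -/
def act (p : Nᵒᵖ ⥤ K ⥤ Type u) : (N ⥤ Type u) ⥤ (K ⥤ Type u) where
  obj a :=
    { obj := fun k => Tensor a (p.flip.obj k)
      map := fun f => TypeCat.ofHom (Tensor.map (𝟙 a) (p.flip.map f))
      map_id := fun k => by
        ext z
        induction z using Tensor.ind with | h n x y
        simp
      map_comp := fun f g => by
        ext z
        induction z using Tensor.ind with | h n x y
        simp }
  map α :=
    { app := fun k => TypeCat.ofHom (Tensor.map α (𝟙 (p.flip.obj k)))
      naturality := fun k k' f => by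
        ext z
        induction z using Tensor.ind with | h n x y
        simp }
  map_id a := by
    ext k z
    induction z using Tensor.ind with | h n x y
    simp
  map_comp α β := by
    ext k z
    induction z using Tensor.ind with | h n x y
    simp

/-- The class of `(x, y) ∈ a(n) × p⟨n, k⟩` in `(p • a)(k)`. -/
def act.mk {p : Nᵒᵖ ⥤ K ⥤ Type u} {a : N ⥤ Type u} {k : K} (n : N)
    (x : a.obj n) (y : (p.obj (op n)).obj k) : ((act p).obj a).obj k :=
  Tensor.mk (X := a) (Y := p.flip.obj k) n x y

theorem act.ind {p : Nᵒᵖ ⥤ K ⥤ Type u} {a : N ⥤ Type u} {k : K}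
    {P : ((act p).obj a).obj k → Prop} (h : ∀ n x y, P (act.mk n x y))
    (z : ((act p).obj a).obj k) : P z :=
  Tensor.ind h z

theorem act.sound {p : Nᵒᵖ ⥤ K ⥤ Type u} {a : N ⥤ Type u} {k : K} {n n' : N} (f : n ⟶ n')
    (x : a.obj n) (y : (p.obj (op n')).obj k) :
    (act.mk n x ((p.map f.op).app k y) : ((act p).obj a).obj k) = act.mk n' (a.map f x) y :=
  Tensor.sound (X := a) (Y := p.flip.obj k) f x y

theorem prof_hom_ext {p q : Nᵒᵖ ⥤ K ⥤ Type u} {α β : p ⟶ q}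
    (h : ∀ n k x, (α.app n).app k x = (β.app n).app k x) : α = β := by
  ext n k x
  exact h n k x

/-- Functoriality of the action in the profunctor. -/
def actMap {p q : Nᵒᵖ ⥤ K ⥤ Type u} (η : p ⟶ q) : act p ⟶ act q where
  app a :=
    { app := fun k => TypeCat.ofHom
        (Tensor.map (𝟙 a) (((flipFunctor Nᵒᵖ K (Type u)).map η).app k))
      naturality := fun k k' f => by
        ext z
        induction z using act.ind with | h n x y
        exact congrArg (act.mk n x) (NatTrans.naturality_apply (η.app (op n)) f y) }
  naturality a a' α := by
    ext k z
    induction z using act.ind with | h n x y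
    rfl

theorem actMap_id (p : Nᵒᵖ ⥤ K ⥤ Type u) : actMap (𝟙 p) = 𝟙 (act p) := by
  ext a k z
  induction z using act.ind with | h n x y
  rfl

theorem actMap_comp {p q r : Nᵒᵖ ⥤ K ⥤ Type u} (η : p ⟶ q) (θ : q ⟶ r) :
    actMap (η ≫ θ) = actMap η ≫ actMap θ := by
  ext a k z
  induction z using act.ind with | h n x y
  rfl

/-- Fubini: `∫^n a(n) × ∫^m p⟨n, m⟩ × q⟨m, k⟩ ≅ ∫^m (∫^n a(n) × p⟨n, m⟩) × q⟨m, k⟩`. -/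
def actComp (p : Nᵒᵖ ⥤ K ⥤ Type u) (q : Kᵒᵖ ⥤ L ⥤ Type u) :
    act (p ⋙ act q) ≅ act p ⋙ act q where
  hom :=
    { app := fun a =>
        { app := fun l => TypeCat.ofHom
            (Tensor.lift (fun n x => Tensor.lift (fun m y z => act.mk m (act.mk n x y) z)
              (fun f y z => act.sound f (act.mk n x y) z))
              (fun f x w => by
                induction w using Tensor.ind with | h m y z
                exact congrArg (fun t => act.mk m t z) (act.sound f x y)))
          naturality := fun l l' f => by
            ext w
            induction w using act.ind with | h n x w
            induction w using act.ind with | h m y z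
            rfl }
      naturality := fun a a' α => by
        ext l w
        induction w using act.ind with | h n x w
        induction w using act.ind with | h m y z
        rfl }
  inv :=
    { app := fun a =>
        { app := fun l => TypeCat.ofHom
            (Tensor.lift (fun m w z => Tensor.lift (X := a) (Y := p.flip.obj m)
                (fun n x y => act.mk n x (act.mk m y z : ((p ⋙ act q).obj (op n)).obj l))
                (fun {_ n'} f x y => act.sound (p := p ⋙ act q) f x
                  (act.mk m y z : ((p ⋙ act q).obj (op n')).obj l)) w)
              (fun f w z => by
                induction w using Tensor.ind with | h n x y
                exact congrArg (fun t => act.mk n x t) (act.sound f y z)))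
          naturality := fun l l' f => by
            ext w
            induction w using act.ind with | h m w z
            induction w using act.ind with | h n x y
            rfl }
      naturality := fun a a' α => by
        ext l w
        induction w using act.ind with | h m w z
        induction w using act.ind with | h n x y
        rfl }
  hom_inv_id := by
    ext a l w
    induction w using act.ind with | h n x w
    induction w using act.ind with | h m y z
    rfl
  inv_hom_id := by
    ext a l w
    induction w using act.ind with | h m w z
    induction w using act.ind with | h n x y
    rfl

/-- Co-Yoneda: `∫^n a(n) × N(n, k) ≅ a(k)`. -/
def actId (N : Type u) [SmallCategory N] : act (coyoneda : Nᵒᵖ ⥤ N ⥤ Type u) ≅ 𝟭 _ where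
  hom :=
    { app := fun a =>
        { app := fun k => TypeCat.ofHom
            (Tensor.lift (fun n x (f : n ⟶ k) => a.map f x) (fun f x g => by
              exact Functor.map_comp_apply a f g x))
          naturality := fun k k' g => by
            ext w
            induction w using act.ind with | h n x f
            exact Functor.map_comp_apply a f g x }
      naturality := fun a a' α => by
        ext l w
        induction w using act.ind with | h n x f
        exact (NatTrans.naturality_apply α f x).symm }
  inv :=
    { app := fun a =>
        { app := fun k => TypeCat.ofHom (fun x => act.mk k x (𝟙 k))
          naturality := fun k k' g => by
            ext x
            refine (act.sound (p := coyoneda) g x (𝟙 k')).symm.trans ?_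
            exact congrArg (act.mk k x) ((Category.comp_id g).trans (Category.id_comp g).symm) }
      naturality := fun a a' α => rfl }
  hom_inv_id := by
    ext a k w
    induction w using act.ind with | h n x f
    refine (act.sound (p := coyoneda) f x (𝟙 k)).symm.trans ?_
    exact congrArg (act.mk n x) (Category.comp_id f)
  inv_hom_id := by
    ext a k x
    change a.map (𝟙 k) x = x
    simp

/-- Co-Yoneda: `∫^m N(n, m) × p⟨m, k⟩ ≅ p⟨n, k⟩`. -/
def homAct (p : Nᵒᵖ ⥤ K ⥤ Type u) : coyoneda ⋙ act p ≅ p where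
  hom :=
    { app := fun n =>
        { app := fun k => TypeCat.ofHom
            (Tensor.lift (fun m (f : n.unop ⟶ m) y => (p.map f.op).app k y) (fun f g y => by
              change _ = (p.map (g ≫ f).op).app k y
              simp))
          naturality := fun k k' g => by
            ext w
            induction w using act.ind with | h m f y
            exact NatTrans.naturality_apply (p.map (Quiver.Hom.op f)) g y }
      naturality := fun n n' g => by
        ext k w
        induction w using act.ind with | h m f y
        change (p.map (g.unop ≫ f).op).app k y = (p.map g).app k ((p.map (Quiver.Hom.op f)).app k y)
        simp }
  inv :=
    { app := fun n =>
        { app := fun k => TypeCat.ofHom (fun y => act.mk n.unop (𝟙 n.unop) y)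
          naturality := fun k k' g => rfl }
      naturality := fun n n' g => by
        ext k y
        refine (act.sound (p := p) (a := coyoneda.obj n') g.unop (𝟙 n'.unop) y).trans ?_
        exact congrArg (fun t => act.mk (p := p) (a := coyoneda.obj n') n.unop t y)
          ((Category.id_comp g.unop).trans (Category.comp_id g.unop).symm) }
  hom_inv_id := by
    ext n k w
    induction w using act.ind with | h m f y
    refine (act.sound (p := p) (a := coyoneda.obj n) f (𝟙 n.unop) y).trans ?_
    exact congrArg (fun t => act.mk (p := p) (a := coyoneda.obj n) m t y) (Category.id_comp f)
  inv_hom_id := by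
    ext n k y
    change (p.map (𝟙 n)).app k y = y
    simp

end Action

/-! ### The bicategory of profunctors -/

/-- The 0-cells of the bicategory of profunctors: small categories. -/
structure Prof : Type (u + 1) where
  /-- The small category as a 0-cell. -/
  of ::
  /-- The underlying type of objects. -/
  carrier : Type u
  [str : SmallCategory carrier]

namespace Prof

instance : CoeSort Prof.{u} (Type u) := ⟨carrier⟩

instance (N : Prof.{u}) : SmallCategory N := N.str

/-- 1-cells `N ⟶ K` are profunctors `Nᵒᵖ × K → Set`, in curried form; the unit is the hom-functor,
and the composite of `p` and `q` is `(p ◇ q)⟨n, k⟩ = ∫^m p⟨n, m⟩ × q⟨m, k⟩`, which is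
`q • p⟨n, -⟩` evaluated at `k`. -/
instance : CategoryStruct Prof.{u} where
  Hom N K := (N : Type u)ᵒᵖ ⥤ (K : Type u) ⥤ Type u
  id _ := coyoneda
  comp p q := p ⋙ act q

/-- 2-cells are natural transformations of profunctors. -/
instance (N K : Prof.{u}) : Category (N ⟶ K) :=
  inferInstanceAs (Category ((N : Type u)ᵒᵖ ⥤ (K : Type u) ⥤ Type u))

instance : Bicategory Prof.{u} where
  whiskerLeft p _ _ η := Functor.whiskerLeft p (actMap η)
  whiskerRight η q := Functor.whiskerRight η (act q)
  associator p q r := Functor.associator p (act q) (act r) ≪≫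
    (Functor.isoWhiskerLeft p (actComp q r)).symm
  leftUnitor p := homAct p
  rightUnitor p := Functor.isoWhiskerLeft p (actId _) ≪≫ p.rightUnitor
  whiskerLeft_id p q := by
    refine prof_hom_ext fun n k w => ?_
    induction w using act.ind with | h m x y
    rfl
  whiskerLeft_comp p _ _ _ η θ := by
    refine prof_hom_ext fun n k w => ?_
    induction w using act.ind with | h m x y
    rfl
  id_whiskerLeft {N K p q} η := by
    refine prof_hom_ext fun n k w => ?_
    induction w using act.ind with | h m f y
    let z : (q.obj (op m)).obj k := (η.app (op m)).app k y
    have h₁ : (η.app n).app k ((p.map (Quiver.Hom.op f)).app k y) =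
        (q.map (Quiver.Hom.op f)).app k z :=
      congrArg (fun α : p.obj (op m) ⟶ q.obj n => α.app k y) (η.naturality (Quiver.Hom.op f))
    have h₂ := act.sound (p := q) (a := coyoneda.obj n) f (𝟙 n.unop) z
    have h₃ : (coyoneda.obj n).map f (𝟙 n.unop) = f := Category.id_comp f
    rw [h₃] at h₂
    exact h₂.symm.trans (congrArg (act.mk (p := q) (a := coyoneda.obj n) n.unop (𝟙 n.unop)) h₁.symm)
  comp_whiskerLeft p q _ _ η := by
    refine prof_hom_ext fun n k w => ?_
    induction w using act.ind with | h m w z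
    induction w using act.ind with | h m' x y
    rfl
  id_whiskerRight p q := by
    refine prof_hom_ext fun n k w => ?_
    induction w using act.ind with | h m x y
    rfl
  comp_whiskerRight η θ q := by
    refine prof_hom_ext fun n k w => ?_
    induction w using act.ind with | h m x y
    rfl
  whiskerRight_id {N K p q} η := by
    refine prof_hom_ext fun n k w => ?_
    induction w using act.ind with | h m x f
    let x' : (q.obj n).obj m := (η.app n).app m x
    have h₁ : (η.app n).app k ((p.obj n).map f x) = (q.obj n).map f x' :=
      NatTrans.naturality_apply (η.app n) f x
    have h₂ := act.sound (p := coyoneda) (a := q.obj n) f x' (𝟙 k)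
    have h₃ : ((coyoneda.map f.op).app k) (𝟙 k) = f := Category.comp_id f
    rw [h₃] at h₂
    exact h₂.trans (congrArg (fun t => act.mk (p := coyoneda) (a := q.obj n) k t (𝟙 k)) h₁.symm)
  whiskerRight_comp η q r := by
    refine prof_hom_ext fun n k w => ?_
    induction w using act.ind with | h m x w
    induction w using act.ind with | h m' y z
    rfl
  whisker_assoc p _ _ η r := by
    refine prof_hom_ext fun n k w => ?_
    induction w using act.ind with | h m w z
    induction w using act.ind with | h m' x y
    rfl
  whisker_exchange η θ := by
    refine prof_hom_ext fun n k w => ?_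
    induction w using act.ind with | h m x y
    rfl
  pentagon p q r s := by
    refine prof_hom_ext fun n k w => ?_
    induction w using act.ind with | h m w z
    induction w using act.ind with | h m' w z'
    induction w using act.ind with | h m'' x y
    rfl
  triangle p q := by
    refine prof_hom_ext fun n k w => ?_
    induction w using act.ind with | h m w z
    induction w using act.ind with | h m' x f
    exact (act.sound (p := q) (a := p.obj n) f x z)

end Prof

/-! ### Pseudofunctors with a given action on cells -/

/-- A pseudofunctor whose action on 0-cells, 1-cells and 2-cells is `S`. -/
structure PseudofunctorOn {B : Type u₁} [Bicategory.{w₁, v₁} B] {C : Type u} [Bicategory.{w, v} C]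
    (S : PrelaxFunctorStruct B C) where
  /-- Preservation of units. -/
  mapId (a : B) : S.map (𝟙 a) ≅ 𝟙 (S.obj a)
  /-- Preservation of composition. -/
  mapComp {a b c : B} (f : a ⟶ b) (g : b ⟶ c) : S.map (f ≫ g) ≅ S.map f ≫ S.map g
  map₂_id {a b : B} (f : a ⟶ b) : S.map₂ (𝟙 f) = 𝟙 (S.map f)
  map₂_comp {a b : B} {f g h : a ⟶ b} (η : f ⟶ g) (θ : g ⟶ h) :
    S.map₂ (η ≫ θ) = S.map₂ η ≫ S.map₂ θ
  map₂_whisker_left {a b c : B} (f : a ⟶ b) {g h : b ⟶ c} (η : g ⟶ h) :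
    S.map₂ (f ◁ η) = (mapComp f g).hom ≫ S.map f ◁ S.map₂ η ≫ (mapComp f h).inv
  map₂_whisker_right {a b c : B} {f g : a ⟶ b} (η : f ⟶ g) (h : b ⟶ c) :
    S.map₂ (η ▷ h) = (mapComp f h).hom ≫ S.map₂ η ▷ S.map h ≫ (mapComp g h).inv
  map₂_associator {a b c d : B} (f : a ⟶ b) (g : b ⟶ c) (h : c ⟶ d) :
    S.map₂ (α_ f g h).hom = (mapComp (f ≫ g) h).hom ≫ (mapComp f g).hom ▷ S.map h ≫
      (α_ (S.map f) (S.map g) (S.map h)).hom ≫ S.map f ◁ (mapComp g h).inv ≫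
      (mapComp f (g ≫ h)).inv
  map₂_left_unitor {a b : B} (f : a ⟶ b) :
    S.map₂ (λ_ f).hom = (mapComp (𝟙 a) f).hom ≫ (mapId a).hom ▷ S.map f ≫ (λ_ (S.map f)).hom
  map₂_right_unitor {a b : B} (f : a ⟶ b) :
    S.map₂ (ρ_ f).hom = (mapComp f (𝟙 b)).hom ≫ S.map f ◁ (mapId b).hom ≫ (ρ_ (S.map f)).hom

/-- The underlying pseudofunctor. -/
def PseudofunctorOn.toPseudofunctor {B : Type u₁} [Bicategory.{w₁, v₁} B] {C : Type u}
    [Bicategory.{w, v} C] {S : PrelaxFunctorStruct B C} (E : PseudofunctorOn S) : B ⥤ᵖ C where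
  toPrelaxFunctorStruct := S
  map₂_id := E.map₂_id
  map₂_comp := E.map₂_comp
  mapId := E.mapId
  mapComp := E.mapComp
  map₂_whisker_left := E.map₂_whisker_left
  map₂_whisker_right := E.map₂_whisker_right
  map₂_associator := E.map₂_associator
  map₂_left_unitor := E.map₂_left_unitor
  map₂_right_unitor := E.map₂_right_unitor

/-- The action of `Prof` on co-presheaves: `N ↦ [N, Set]` on 0-cells, `p ↦ p • -` on 1-cells, and
the induced natural transformations on 2-cells. -/
def copresheafAction : PrelaxFunctorStruct Prof.{u} Cat.{u, u + 1} where
  obj N := Cat.of ((N : Type u) ⥤ Type u)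
  map p := (act p).toCatHom
  map₂ η := (actMap η).toCatHom₂

/-! ### Compound optics -/

section Optic

/-- Left Kan extension of `H` along `P`, contravariantly functorial in `P`. -/
noncomputable def lanAlong {X : Type u₁} [Category.{v₁} X] {Y : Type u} [Category.{v} Y]
    (H : X ⥤ Type w) [∀ P : X ⥤ Y, P.HasLeftKanExtension H] : (X ⥤ Y)ᵒᵖ ⥤ (Y ⥤ Type w) where
  obj P := P.unop.leftKanExtension H
  map {P Q} α := P.unop.leftKanExtension H |>.descOfIsLeftKanExtension
    (P.unop.leftKanExtensionUnit H) (Q.unop.leftKanExtension H)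
    (Q.unop.leftKanExtensionUnit H ≫ Functor.whiskerRight α.unop (Q.unop.leftKanExtension H))
  map_id P := by
    apply Functor.hom_ext_of_isLeftKanExtension _ (P.unop.leftKanExtensionUnit H)
    ext x y
    simp
  map_comp {P Q R} α β := by
    apply Functor.hom_ext_of_isLeftKanExtension _ (P.unop.leftKanExtensionUnit H)
    ext x y
    simp

variable {M : Type u₁} [Bicategory.{w₁, v₁} M] (F G : M ⥤ᵖ Cat.{v, u}) {i j : M}

/-- The mixed-variance action `⟨m, m'⟩ • ⟨c, d⟩ = ⟨F m c, G m' d⟩`. -/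
def mixedAction (i j : M) :
    (i ⟶ j)ᵒᵖ × (i ⟶ j) ⥤ ((F.obj i)ᵒᵖ × G.obj i ⥤ (F.obj j)ᵒᵖ × G.obj j) where
  obj m := (F.map m.1.unop).toFunctor.op.prod (G.map m.2).toFunctor
  map α := NatTrans.prod (NatTrans.op (F.map₂ α.1.unop).toNatTrans) (G.map₂ α.2).toNatTrans

/-- The representable `⟨c, d⟩ ↦ C(c, a) × D(b, d)` on `Cᵒᵖ × D`. -/
def representable (a : F.obj i) (b : G.obj i) :
    (F.obj i)ᵒᵖ × G.obj i ⥤ Type (max u v v₁) :=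
  coyoneda.obj (op (op a, b)) ⋙ uliftFunctor.{max u v₁}

/-- `⟨m, m'⟩ ↦ (Lan_{⟨m, m'⟩ •} 𝒴_{⟨a, b⟩}) ⟨s, t⟩`, covariant in `m` and contravariant in `m'`. -/
noncomputable def opticIntegrand (a : F.obj i) (b : G.obj i) (s : F.obj j) (t : G.obj j) :
    ((i ⟶ j)ᵒᵖ × (i ⟶ j))ᵒᵖ ⥤ Type (max u v v₁) :=
  (mixedAction F G i j).op ⋙ lanAlong (representable F G a b) ⋙ (evaluation _ _).obj (op s, t)

/-- The integrand of the compound optic with its variables separated: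
`(m', m) ↦ (Lan_{⟨m, m'⟩ •} 𝒴_{⟨a, b⟩}) ⟨s, t⟩`. -/
noncomputable def opticDiagram (a : F.obj i) (b : G.obj i) (s : F.obj j) (t : G.obj j) :
    (i ⟶ j)ᵒᵖ ⥤ (i ⟶ j) ⥤ Type (max u v v₁) where
  obj m' :=
    { obj := fun m => (opticIntegrand F G a b s t).obj (op (op m, m'.unop))
      map := fun α => (opticIntegrand F G a b s t).map (Prod.mkHom α.op (𝟙 m'.unop)).op
      map_id := fun m => (opticIntegrand F G a b s t).map_id (op (op m, m'.unop))
      map_comp := fun α β => by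
        rw [← Functor.map_comp, ← op_comp, prod_comp, Category.comp_id]
        rfl }
  map β :=
    { app := fun m => (opticIntegrand F G a b s t).map (Prod.mkHom (𝟙 (op m)) β.unop).op
      naturality := fun m n α => by
        dsimp only
        rw [← Functor.map_comp, ← Functor.map_comp, ← op_comp, ← op_comp, prod_comp, prod_comp]
        simp }
  map_id m' := by
    ext m : 2
    exact (opticIntegrand F G a b s t).map_id (op (op m, m'.unop))
  map_comp β γ := by
    ext m : 2
    rw [NatTrans.comp_app, ← Functor.map_comp, ← op_comp, prod_comp, Category.comp_id]
    rfl

/-- The compound optic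
`𝒪_{i,j}⟨a, b⟩⟨s, t⟩ = ∫^{m : M(i, j)} (Lan_{⟨m, m⟩ •} 𝒴_{⟨a, b⟩}) ⟨s, t⟩`. -/
def CompoundOptic (a : F.obj i) (b : G.obj i) (s : F.obj j) (t : G.obj j) : Type (max u v v₁) :=
  coend.{max u v, w₁, v₁} (opticDiagram F G a b s t)

/-- The element of the compound optic determined by a 1-cell `m` and a morphism
`⟨f, g⟩ : ⟨m, m⟩ • ⟨a, b⟩ ⟶ ⟨s, t⟩` of `C'ᵒᵖ × D'`: the class of the image under `⟨f, g⟩` of the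
identity of `⟨a, b⟩`, carried into the Kan extension by its unit. -/
noncomputable def CompoundOptic.mk {a : F.obj i} {b : G.obj i} {s : F.obj j} {t : G.obj j}
    (m : i ⟶ j) (f : s ⟶ (F.map m).toFunctor.obj a) (g : (G.map m).toFunctor.obj b ⟶ t) :
    CompoundOptic F G a b s t :=
  let P := (mixedAction F G i j).obj (op m, m)
  let fg : P.obj (op a, b) ⟶ (op s, t) := Prod.mkHom f.op g
  Quot.mk _ ⟨m, (P.leftKanExtension (representable F G a b)).map fg
    ((P.leftKanExtensionUnit (representable F G a b)).app (op a, b) (ULift.up (𝟙 (op a, b))))⟩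

end Optic

/-! ### The optic of co-presheaves as a coend over profunctors -/

section CopresheafOptic

variable {N K : Type u} [SmallCategory N] [SmallCategory K]

/-- The integrand `(q, p) ↦ [K, Set](s, p • a) × [K, Set](q • b, t)`. -/
def copresheafOpticDiagram (a b : N ⥤ Type u) (s t : K ⥤ Type u) :
    (Nᵒᵖ ⥤ K ⥤ Type u)ᵒᵖ ⥤ (Nᵒᵖ ⥤ K ⥤ Type u) ⥤ Type (u + 1) where
  obj q :=
    { obj := fun p => ULift.{u + 1} ((s ⟶ (act p).obj a) × ((act q.unop).obj b ⟶ t))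
      map := fun η => TypeCat.ofHom fun z => ⟨(z.down.1 ≫ (actMap η).app a, z.down.2)⟩
      map_id := fun p => by
        refine congrArg TypeCat.ofHom (funext fun z => congrArg ULift.up (Prod.ext ?_ rfl))
        exact (congrArg (fun α => z.down.1 ≫ α.app a) (actMap_id p)).trans (Category.comp_id _)
      map_comp := fun η θ => by
        refine congrArg TypeCat.ofHom (funext fun z => congrArg ULift.up (Prod.ext ?_ rfl))
        exact (congrArg (fun α => z.down.1 ≫ α.app a) (actMap_comp η θ)).trans
          (Category.assoc _ _ _).symm }
  map θ :=
    { app := fun p => TypeCat.ofHom fun z => ⟨(z.down.1, (actMap θ.unop).app b ≫ z.down.2)⟩ }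
  map_id q := by
    refine NatTrans.ext (funext fun p => congrArg TypeCat.ofHom
      (funext fun z => congrArg ULift.up (Prod.ext rfl ?_)))
    exact (congrArg (fun α => α.app b ≫ z.down.2) (actMap_id q.unop)).trans (Category.id_comp _)
  map_comp η θ := by
    refine NatTrans.ext (funext fun p => congrArg TypeCat.ofHom
      (funext fun z => congrArg ULift.up (Prod.ext rfl ?_)))
    exact (congrArg (fun α => α.app b ≫ z.down.2) (actMap_comp θ.unop η.unop)).trans
      (Category.assoc _ _ _)

/-- The coend
`∫^p [K, Set](s, ∫^n a(n) × p⟨n, -⟩) × [K, Set](∫^n' b(n') × p⟨n', -⟩, t)` over profunctors `p`. -/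
def CopresheafOptic (a b : N ⥤ Type u) (s t : K ⥤ Type u) : Type (u + 1) :=
  coend.{u + 1, u, u + 1} (copresheafOpticDiagram a b s t)

/-- The class of a pair of natural transformations in the coend over profunctors. -/
def CopresheafOptic.mk {a b : N ⥤ Type u} {s t : K ⥤ Type u} (p : Nᵒᵖ ⥤ K ⥤ Type u)
    (f : s ⟶ (act p).obj a) (g : (act p).obj b ⟶ t) : CopresheafOptic a b s t :=
  Quot.mk _ ⟨p, ⟨(f, g)⟩⟩

end CopresheafOptic

/-! ### Polynomial lenses and ommatidia -/

section Polynomial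

variable {N K : Type u}

/-- The polynomial functor `y ↦ ∑_{k ∈ K} s_k × Set(t_k, y)`. -/
def poly (s t : K → Type u) : Type u ⥤ Type u where
  obj y := Σ k, s k × (t k → y)
  map h := TypeCat.ofHom fun z => ⟨z.1, z.2.1, fun r => h (z.2.2 r)⟩

/-- `PolyLens⟨s, t⟩⟨a, b⟩ = ∏_{k ∈ K} Set(s_k, ∑_{n ∈ N} a_n × Set(b_n, t_k))`. -/
def PolyLens (s t : K → Type u) (a b : N → Type u) : Type u :=
  ∀ k, s k → Σ n, a n × (b n → t k)

/-- The integrand `(c', c) ↦ ∏_k Set(s_k, ∑_n a_n × c_{nk}) × ∏_i Set(∑_m b_m × c'_{mi}, t_i)`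
on the category of families of sets indexed over `N` and `K`. -/
def ommatidiaDiagram (s t : K → Type u) (a b : N → Type u) :
    (N → K → Type u)ᵒᵖ ⥤ (N → K → Type u) ⥤ Type (u + 1) where
  obj c' :=
    { obj := fun c => ULift.{u + 1}
        ((∀ k, s k → Σ n, a n × c n k) × (∀ i, (Σ m, b m × c'.unop m i) → t i))
      map := fun h => TypeCat.ofHom fun z =>
        ⟨(fun k e => ⟨(z.down.1 k e).1, (z.down.1 k e).2.1, h _ k (z.down.1 k e).2.2⟩,
          z.down.2)⟩ }
  map h :=
    { app := fun c => TypeCat.ofHom fun z =>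
        ⟨(z.down.1, fun i e => z.down.2 i ⟨e.1, e.2.1, h.unop _ i e.2.2⟩)⟩ }

/-- The ommatidia coend
`∫^c ∏_k Set(s_k, ∑_n a_n × c_{nk}) × ∏_i Set(∑_m b_m × c_{mi}, t_i)`. -/
def Ommatidia (s t : K → Type u) (a b : N → Type u) : Type (u + 1) :=
  coend.{u + 1, u, u + 1} (ommatidiaDiagram s t a b)

/-- The class of a pair of families of functions in the ommatidia coend. -/
def Ommatidia.mk {s t : K → Type u} {a b : N → Type u} (c : N → K → Type u)
    (f : ∀ k, s k → Σ n, a n × c n k) (g : ∀ i, (Σ m, b m × c m i) → t i) :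
    Ommatidia s t a b :=
  Quot.mk _ ⟨c, ⟨(f, g)⟩⟩

end Polynomial

end CompoundOptics

namespace CompoundOptics

open Limits.Types (coend coend.ι coendRel)

/-! ### The action of profunctors as a pseudofunctor -/

/-! All four parts come down to computing with representatives of coend classes. The coherence laws
of the pseudofunctor need checking only on iterated classes such as `[n, x, [m, y, z]]`, where both
sides reduce to the same class, by computation or by one instance of the coend relation.

The optic formula is the Yoneda lemma for Kan extensions: a left Kan extension of a representable
`X(x, -)` along `P` is represented by `P x` (`bijective_of_isLeftKanExtension_coyoneda`). The
integrand is therefore a set of morphisms `⟨f, g⟩` in an opposite-times-plain product category, that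
is, of pairs of natural transformations. `opticIntegrand_map_mk` makes this natural in both
occurrences of the profunctor, and `coendCongr` carries it to the coends.

In the discrete case, `g` can be transposed to a map from `c_{nk}` to `Set(b_n, t_k)`. The coend
relation then replaces `c` by this universal family and `g` by evaluation, so only the transported
`f` is left, and this is a polynomial lens. The same argument serves profunctors between discrete
categories and families of sets, and the two coends are compared through lenses. The last bijection
is the Yoneda lemma in each summand of the polynomial. -/

theorem copresheafAction_hom₂_ext {N K : Prof.{u}}
    {S T : copresheafAction.{u}.obj N ⟶ copresheafAction.{u}.obj K} {α β : S ⟶ T}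
    (h : ∀ (a : (N : Type u) ⥤ Type u) (k : K) (z : (S.toFunctor.obj a : K ⥤ Type u).obj k),
      NatTrans.app (α.toNatTrans.app a) k z = NatTrans.app (β.toNatTrans.app a) k z) :
    α = β := by
  apply Cat.Hom₂.ext
  apply NatTrans.ext
  funext a
  apply NatTrans.ext
  funext k
  apply ConcreteCategory.hom_ext
  exact h a k

/-- The action of profunctors on co-presheaves is a pseudofunctor, with the Fubini and co-Yoneda
isomorphisms as constraints. -/
def copresheafPseudofunctor : PseudofunctorOn copresheafAction.{u} where
  mapId N := Cat.Hom.isoMk (actId N)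
  mapComp p q := Cat.Hom.isoMk (actComp p q)
  map₂_id p := by
    refine copresheafAction_hom₂_ext fun a k w => ?_
    induction w using act.ind with | h n x y
    rfl
  map₂_comp η θ := by
    refine copresheafAction_hom₂_ext fun a k w => ?_
    induction w using act.ind with | h n x y
    rfl
  map₂_whisker_left p _ _ η := by
    refine copresheafAction_hom₂_ext fun a k w => ?_
    induction w using act.ind with | h n x w
    induction w using act.ind with | h m y z
    rfl
  map₂_whisker_right η q := by
    refine copresheafAction_hom₂_ext fun a k w => ?_
    induction w using act.ind with | h n x w
    induction w using act.ind with | h m y z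
    rfl
  map₂_associator p q r := by
    refine copresheafAction_hom₂_ext fun a k w => ?_
    induction w using act.ind with | h n x w
    induction w using act.ind with | h m w z
    induction w using act.ind with | h m' y y'
    rfl
  map₂_left_unitor p := by
    refine copresheafAction_hom₂_ext fun a k w => ?_
    induction w using act.ind with | h n x w
    induction w using act.ind with | h m f y
    -- The two sides are `[n, x, p(f)(y)]` and `[m, a(f)(x), y]`, which only the coend relation
    -- identifies. For the right unitor both sides compute to the same representative.
    exact act.sound f x y
  map₂_right_unitor p := by
    refine copresheafAction_hom₂_ext fun a k w => ?_
    induction w using act.ind with | h n x w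
    induction w using act.ind with | h m y f
    rfl

/-! ### Left Kan extensions of representables and compound optics -/

section Lan

variable {X : Type u₁} [Category.{v} X] {Y : Type u} [Category.{v} Y]

theorem isLeftKanExtension_leftKanExtensionUnit {X : Type u₁} [Category.{v₁} X]
    {Y : Type u} [Category.{v} Y] (P : X ⥤ Y) (H : X ⥤ Type w) [P.HasLeftKanExtension H] :
    (P.leftKanExtension H).IsLeftKanExtension (P.leftKanExtensionUnit H) := inferInstance

/-- A left Kan extension along `P` of the functor represented by `x` is represented by `P x`. -/
theorem bijective_of_isLeftKanExtension_coyoneda (P : X ⥤ Y) (x : X)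
    (L : Y ⥤ Type (max w v))
    (α : coyoneda.obj (op x) ⋙ uliftFunctor.{w} ⟶ P ⋙ L) (_ : L.IsLeftKanExtension α) (y : Y) :
    Function.Bijective fun f : P.obj x ⟶ y => L.map f (α.app x (ULift.up (𝟙 x))) := by
  let L' : Y ⥤ Type (max w v) := coyoneda.obj (op (P.obj x)) ⋙ uliftFunctor.{w}
  let β : coyoneda.obj (op x) ⋙ uliftFunctor.{w} ⟶ P ⋙ L' :=
    { app := fun z => TypeCat.ofHom fun h => ULift.up (P.map h.down)
      naturality := fun z z' h => by
        ext k
        exact congrArg ULift.up (P.map_comp k.down h) }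
  let ψ : L' ⟶ L :=
    { app := fun z => TypeCat.ofHom fun f => L.map f.down (α.app x (ULift.up (𝟙 x)))
      naturality := fun z z' h => by
        ext f
        exact Functor.map_comp_apply L f.down h _ }
  -- `δ` comes from the universal property of `L`, while `ψ` is the Yoneda map of the element `α(𝟙
  -- x)`; they turn out to be mutually inverse.
  let δ : L ⟶ L' := L.descOfIsLeftKanExtension α L' β
  have hδ : ∀ z h, δ.app (P.obj z) (α.app z h) = ULift.up (P.map h.down) := fun z h =>
    congrArg (fun k => k h) (L.descOfIsLeftKanExtension_fac_app α L' β z)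
  -- Endomorphisms of `L` are determined after restriction along `α`. There, naturality of `α` at `h
  -- : x ⟶ z` recovers `α(h)` from `α(𝟙 x)`.
  have hψ : δ ≫ ψ = 𝟙 L := by
    apply Functor.hom_ext_of_isLeftKanExtension _ α
    ext z h
    refine (congrArg (ψ.app (P.obj z)) (hδ z h)).trans ?_
    refine (congrArg (fun k => k (ULift.up (𝟙 x))) (α.naturality h.down)).symm.trans ?_
    exact congrArg (fun k : (coyoneda.obj (op x) ⋙ uliftFunctor.{w}).obj z => α.app z k)
      (congrArg ULift.up (Category.id_comp h.down))
  constructor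
  · refine Function.LeftInverse.injective (g := fun z => (δ.app y z).down) fun f => ?_
    refine congrArg ULift.down ((NatTrans.naturality_apply δ f _).trans
      (congrArg (L'.map f) (hδ x (ULift.up (𝟙 x))))) |>.trans ?_
    change P.map (𝟙 x) ≫ f = f
    simp
  · intro z
    exact ⟨(δ.app y z).down, congrArg (fun k => k z) (congrArg (fun γ => γ.app y) hψ)⟩

/-- This is the triangle that characterises the transition map of `lanAlong`, read at an element. -/
theorem lanAlong_map_unit {X : Type u₁} [Category.{v₁} X] {Y : Type u} [Category.{v} Y]
    (H : X ⥤ Type w) [∀ P : X ⥤ Y, P.HasLeftKanExtension H] {P Q : X ⥤ Y} (β : P ⟶ Q)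
    (x : X) (h : H.obj x) :
    ((lanAlong H).map β.op).app (Q.obj x) ((Q.leftKanExtensionUnit H).app x h) =
      (P.leftKanExtension H).map (β.app x) ((P.leftKanExtensionUnit H).app x h) :=
  congrArg (fun k : H.obj x ⟶ (P.leftKanExtension H).obj (Q.obj x) => k h)
    (Functor.descOfIsLeftKanExtension_fac_app (Q.leftKanExtension H) (Q.leftKanExtensionUnit H)
      (P.leftKanExtension H)
      (P.leftKanExtensionUnit H ≫ Functor.whiskerRight β (P.leftKanExtension H)) x)

end Lan

section Optic

variable {M : Type u₁} [Bicategory.{w₁, v₁} M] (F G : M ⥤ᵖ Cat.{v, u}) {i j : M}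
  {a : F.obj i} {b : G.obj i} {s : F.obj j} {t : G.obj j}

/-- The element of the Kan extension along `⟨m, m'⟩ •` assigned to a morphism
`⟨f, g⟩ : ⟨m, m'⟩ • ⟨a, b⟩ ⟶ ⟨s, t⟩`. -/
noncomputable def opticIntegrandMk (m m' : i ⟶ j) (f : s ⟶ (F.map m).toFunctor.obj a)
    (g : (G.map m').toFunctor.obj b ⟶ t) : (opticIntegrand F G a b s t).obj (op (op m, m')) :=
  let P := (mixedAction F G i j).obj (op m, m')
  let fg : P.obj (op a, b) ⟶ (op s, t) := Prod.mkHom f.op g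
  (P.leftKanExtension (representable F G a b)).map fg
    ((P.leftKanExtensionUnit (representable F G a b)).app (op a, b) (ULift.up (𝟙 (op a, b))))

/-- The functor being extended is represented by `⟨a, b⟩`, so its extension is represented by `⟨m,
m'⟩ • ⟨a, b⟩`; morphisms from there to `⟨s, t⟩` are pairs whose first component is reversed. -/
theorem bijective_opticIntegrandMk (m m' : i ⟶ j) :
    Function.Bijective fun fg : (s ⟶ (F.map m).toFunctor.obj a) ×
      ((G.map m').toFunctor.obj b ⟶ t) => opticIntegrandMk F G m m' fg.1 fg.2 := by
  let P := (mixedAction F G i j).obj (op m, m')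
  let e : (s ⟶ (F.map m).toFunctor.obj a) × ((G.map m').toFunctor.obj b ⟶ t) ≃
      (P.obj (op a, b) ⟶ (op s, t)) :=
    { toFun := fun fg => Prod.mkHom fg.1.op fg.2
      invFun := fun h => (h.1.unop, h.2)
      left_inv := fun _ => rfl
      right_inv := fun _ => rfl }
  exact (bijective_of_isLeftKanExtension_coyoneda.{max u v₁} P (op a, b)
    (P.leftKanExtension (representable F G a b))
    (P.leftKanExtensionUnit (representable F G a b))
    (isLeftKanExtension_leftKanExtensionUnit P _) (op s, t)).comp e.bijective

/-- Naturality of the representation in both 1-cells: the transition map slides past `⟨f, g⟩`, acts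
on the unit by `lanAlong_map_unit`, and the two resulting morphisms compose. -/
theorem opticIntegrand_map_mk {m₁ m₂ m₁' m₂' : i ⟶ j} (η : m₂ ⟶ m₁) (θ : m₁' ⟶ m₂')
    (f : s ⟶ (F.map m₂).toFunctor.obj a) (g : (G.map m₂').toFunctor.obj b ⟶ t) :
    (opticIntegrand F G a b s t).map
        (Prod.mkHom (X₁ := op m₁) (X₂ := op m₂) (Y₁ := m₁') (Y₂ := m₂') η.op θ).op
        (opticIntegrandMk F G m₂ m₂' f g) =
      opticIntegrandMk F G m₁ m₁' (f ≫ (F.map₂ η).toNatTrans.app a)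
        ((G.map₂ θ).toNatTrans.app b ≫ g) := by
  let H := representable F G a b
  let β := (mixedAction F G i j).map
    (Prod.mkHom (X₁ := op m₁) (X₂ := op m₂) (Y₁ := m₁') (Y₂ := m₂') η.op θ)
  let fg : ((mixedAction F G i j).obj (op m₂, m₂')).obj (op a, b) ⟶ (op s, t) :=
    Prod.mkHom f.op g
  refine (NatTrans.naturality_apply ((lanAlong H).map β.op) fg _).trans ?_
  refine (congrArg _ (lanAlong_map_unit H β (op a, b) _)).trans ?_
  exact (Functor.map_comp_apply _ (β.app (op a, b)) fg _).symm

end Optic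

/-! ### Isomorphic diagrams have isomorphic coends -/

section Coend

variable {J : Type u₁} [Category.{v₁} J]

/-- A natural bijection of integrands induces a bijection of coends. -/
noncomputable def coendCongr {A B : Jᵒᵖ ⥤ J ⥤ Type (max w u₁)}
    (e : ∀ j' j, (A.obj j').obj j → (B.obj j').obj j)
    (he : ∀ j' j, Function.Bijective (e j' j))
    (h₁ : ∀ {j' k' : Jᵒᵖ} (f : j' ⟶ k') (j : J) (x : (A.obj j').obj j),
      e k' j ((A.map f).app j x) = (B.map f).app j (e j' j x))
    (h₂ : ∀ (j' : Jᵒᵖ) {j k : J} (f : j ⟶ k) (x : (A.obj j').obj j),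
      e j' k ((A.obj j').map f x) = (B.obj j').map f (e j' j x)) :
    coend.{w, v₁, u₁} A ≃ coend.{w, v₁, u₁} B :=
  Quot.congr (Equiv.sigmaCongrRight fun j => Equiv.ofBijective _ (he (op j) j)) <| by
    rintro ⟨j, x⟩ ⟨k, y⟩
    rw [Limits.Types.coendRel_iff]
    refine Iff.trans ?_ (Limits.Types.coendRel_iff B j k (e _ _ x) (e _ _ y)).symm
    constructor
    · rintro ⟨f, z, rfl, rfl⟩
      exact ⟨f, e _ _ z, (h₁ _ _ _).symm, (h₂ _ _ _).symm⟩
    -- Reflecting the relation takes surjectivity off the diagonal, to lift the witness `z`, and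
    -- injectivity on it, to identify the endpoints.
    · rintro ⟨f, z, hx, hy⟩
      obtain ⟨z, rfl⟩ := (he _ _).2 z
      exact ⟨f, z, (he _ _).1 ((h₁ _ _ _).trans hx), (he _ _).1 ((h₂ _ _ _).trans hy)⟩

end Coend

/-- The compound optic of co-presheaves is a coend over profunctors. -/
theorem exists_copresheafOptic_equiv (N K : Prof.{u}) (a b : N ⥤ Type u) (s t : K ⥤ Type u) :
    ∃ e : CopresheafOptic a b s t ≃ CompoundOptic copresheafPseudofunctor.toPseudofunctor
        copresheafPseudofunctor.toPseudofunctor (i := N) (j := K) a b s t,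
      ∀ (p : N ⟶ K) (f : s ⟶ (act p).obj a) (g : (act p).obj b ⟶ t),
        e (CopresheafOptic.mk p f g) = CompoundOptic.mk copresheafPseudofunctor.toPseudofunctor
          copresheafPseudofunctor.toPseudofunctor p f g := by
  let E := copresheafPseudofunctor.{u}.toPseudofunctor
  let e : ∀ (q : (N ⟶ K)ᵒᵖ) (p : N ⟶ K),
      ULift.{u + 1} ((s ⟶ (act p).obj a) × ((act q.unop).obj b ⟶ t)) →
      ((opticDiagram E E (i := N) (j := K) a b s t).obj q).obj p := fun q p z =>
    opticIntegrandMk (i := N) (j := K) (a := a) (b := b) (s := s) (t := t) E E p q.unop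
      z.down.1 z.down.2
  refine ⟨coendCongr.{u + 1} (J := N ⟶ K) (A := copresheafOpticDiagram a b s t)
    (B := opticDiagram E E (i := N) (j := K) a b s t) e
    (fun q p => (bijective_opticIntegrandMk E E p q.unop).comp Equiv.ulift.bijective) ?_ ?_, ?_⟩
  · intro q q' θ p z
    -- Varying one variable is a map of pairs with an identity in the other, so a superfluous
    -- `actMap (𝟙 p)` has to be removed.
    refine Eq.trans ?_ (opticIntegrand_map_mk E E (𝟙 p) θ.unop z.down.1 z.down.2).symm
    exact congrArg (fun f => opticIntegrandMk (i := N) (j := K) (a := a) (b := b) (s := s) (t := t)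
      E E p q'.unop f ((actMap θ.unop).app b ≫ z.down.2))
      ((congrArg (fun α => z.down.1 ≫ α.app a) (actMap_id p)).trans (Category.comp_id _)).symm
  · intro q p p' η z
    refine Eq.trans ?_ (opticIntegrand_map_mk E E η (𝟙 q.unop) z.down.1 z.down.2).symm
    exact congrArg (opticIntegrandMk (i := N) (j := K) (a := a) (b := b) (s := s) (t := t)
      E E p' q.unop (z.down.1 ≫ (actMap η).app a))
      ((congrArg (fun α => α.app b ≫ z.down.2) (actMap_id q.unop)).trans (Category.id_comp _)).symm
  · intro p f g
    rfl

/-! ### The discrete case -/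

section Discrete

variable {N K : Type u}

theorem bijective_discrete_natTrans_app (X Y : Discrete K ⥤ Type u) :
    Function.Bijective fun (f : X ⟶ Y) (k : K) (x : X.obj ⟨k⟩) => f.app ⟨k⟩ x := by
  constructor
  · intro f g h
    ext ⟨k⟩ x
    exact congrFun (congrFun h k) x
  · intro h
    exact ⟨Discrete.natTrans fun k => TypeCat.ofHom (h k.as), rfl⟩

/-- For discrete `N` and `K`, the coend `(p • r)(k)` is the coproduct `∑_n r_n × p⟨n, k⟩`. -/
def actDiscreteEquiv (p : (Discrete N)ᵒᵖ ⥤ Discrete K ⥤ Type u) (r : N → Type u) (k : K) :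
    ((act p).obj (Discrete.functor r)).obj ⟨k⟩ ≃ Σ n, r n × (p.obj (op ⟨n⟩)).obj ⟨k⟩ where
  toFun := Tensor.lift (X := Discrete.functor r) (Y := p.flip.obj ⟨k⟩)
    (fun n x y => ⟨n.as, x, y⟩) (by
      -- A discrete category has only identities, so the coend relation imposes nothing.
      rintro ⟨m⟩ ⟨m'⟩ f x y
      obtain rfl := Discrete.eq_of_hom f
      obtain rfl : f = 𝟙 _ := Subsingleton.elim _ _
      simp)
  invFun z := act.mk ⟨z.1⟩ z.2.1 z.2.2
  left_inv z := by
    induction z using act.ind with | h n x y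
    rfl
  right_inv z := rfl

theorem CopresheafOptic.mk_eq_of_hom {N K : Type u} [SmallCategory N] [SmallCategory K]
    {a b : N ⥤ Type u} {s t : K ⥤ Type u} {p q : Nᵒᵖ ⥤ K ⥤ Type u} (η : p ⟶ q)
    (f : s ⟶ (act p).obj a) (g : (act q).obj b ⟶ t) :
    CopresheafOptic.mk p f ((actMap η).app b ≫ g) =
      CopresheafOptic.mk q (f ≫ (actMap η).app a) g :=
  Quot.sound (coendRel.mk.{u + 1, u, u + 1} (F := copresheafOpticDiagram a b s t) η ⟨(f, g)⟩)

/-- The generating relation of the coend; it is what allows `c` to be replaced by `Set(b_n, t_k)`.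
-/
theorem Ommatidia.mk_eq_of_hom {s t : K → Type u} {a b : N → Type u} {c d : N → K → Type u}
    (h : ∀ n k, c n k → d n k) (f : ∀ k, s k → Σ n, a n × c n k)
    (g : ∀ i, (Σ m, b m × d m i) → t i) :
    (Ommatidia.mk c f fun i e => g i ⟨e.1, e.2.1, h _ _ e.2.2⟩) =
      Ommatidia.mk d (fun k e => ⟨(f k e).1, (f k e).2.1, h _ _ (f k e).2.2⟩) g :=
  Quot.sound (coendRel.mk.{u + 1, u, u + 1} (F := ommatidiaDiagram s t a b)
    (fun n k => TypeCat.ofHom (h n k)) ⟨(f, g)⟩)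

/-- The ommatidia coend is the set of polynomial lenses. -/
def ommatidiaEquiv (s t : K → Type u) (a b : N → Type u) :
    Ommatidia s t a b ≃ PolyLens s t a b where
  toFun := Quot.lift (fun z k x => ⟨(z.2.down.1 k x).1, (z.2.down.1 k x).2.1, fun y =>
    z.2.down.2 k ⟨(z.2.down.1 k x).1, y, (z.2.down.1 k x).2.2⟩⟩) (by
      rintro _ _ ⟨h, z⟩
      rfl)
  -- The universal family is `Set(b_n, t_k)`, with evaluation as its second component.
  invFun l := Ommatidia.mk (fun n k => b n → t k) l fun _ z => z.2.2 z.2.1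
  left_inv := by
    rintro ⟨c, ⟨f, g⟩⟩
    -- The transpose of `g` maps `c` to the universal family, and evaluation after it gives back
    -- `g`.
    exact (Ommatidia.mk_eq_of_hom (d := fun n k => b n → t k)
      (fun n k v y => g k ⟨n, y, v⟩) f fun _ z => z.2.2 z.2.1).symm
  right_inv l := rfl

/-- The natural transformation between profunctors on discrete categories given by a family of
functions. -/
def discreteProfHom {p q : (Discrete N)ᵒᵖ ⥤ Discrete K ⥤ Type u}
    (h : ∀ n k, (p.obj (op ⟨n⟩)).obj ⟨k⟩ → (q.obj (op ⟨n⟩)).obj ⟨k⟩) : p ⟶ q where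
  app n := Discrete.natTrans fun k => TypeCat.ofHom (h n.unop.as k.as)
  naturality := by
    rintro ⟨⟨n⟩⟩ ⟨⟨n'⟩⟩ f
    obtain rfl : n' = n := Discrete.eq_of_hom f.unop
    obtain rfl : f = 𝟙 _ := Quiver.Hom.unop_inj (Subsingleton.elim _ _)
    rw [p.map_id, q.map_id, Category.id_comp, Category.comp_id]

/-- The profunctor `⟨n, k⟩ ↦ Set(b_n, t_k)` between discrete categories. -/
def homProfunctor (b : N → Type u) (t : K → Type u) : (Discrete N)ᵒᵖ ⥤ Discrete K ⥤ Type u :=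
  (Discrete.opposite N).functor ⋙ Discrete.functor fun n => Discrete.functor fun k => b n → t k

/-- The polynomial lens of a pair of natural transformations. -/
def polyLensOfProf {s t : K → Type u} {a b : N → Type u}
    (p : (Discrete N)ᵒᵖ ⥤ Discrete K ⥤ Type u)
    (f : Discrete.functor s ⟶ (act p).obj (Discrete.functor a))
    (g : (act p).obj (Discrete.functor b) ⟶ Discrete.functor t) : PolyLens s t a b := fun k x =>
  let w := actDiscreteEquiv p a k (f.app ⟨k⟩ x)
  ⟨w.1, w.2.1, fun y => g.app ⟨k⟩ (act.mk ⟨w.1⟩ y w.2.2)⟩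

/-- The optic of co-presheaves on discrete categories is the set of polynomial lenses. -/
def copresheafOpticEquivPolyLens (s t : K → Type u) (a b : N → Type u) :
    CopresheafOptic (Discrete.functor a) (Discrete.functor b) (Discrete.functor s)
      (Discrete.functor t) ≃ PolyLens s t a b where
  toFun := Quot.lift (fun z => polyLensOfProf z.1 z.2.down.1 z.2.down.2) (by
    rintro _ _ ⟨η, ⟨f, g⟩⟩
    funext k x
    change polyLensOfProf _ f ((actMap η).app (Discrete.functor b) ≫ g) k x =
      polyLensOfProf _ (f ≫ (actMap η).app (Discrete.functor a)) g k x
    simp only [polyLensOfProf, NatTrans.comp_app, types_comp_apply]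
    -- Only the value of `f` at `x` matters, and it may be taken to be the class of a
    -- representative.
    generalize f.app ⟨k⟩ x = w
    induction w using act.ind with | h n y z
    rfl)
  invFun l := CopresheafOptic.mk (homProfunctor b t)
    (Discrete.natTrans fun k => TypeCat.ofHom fun x =>
      (actDiscreteEquiv (homProfunctor b t) a k.as).symm (l k.as x))
    (Discrete.natTrans fun k => TypeCat.ofHom fun z =>
      let w := actDiscreteEquiv (homProfunctor b t) b k.as z
      (show b w.1 → t k.as from w.2.2) w.2.1)
  left_inv := by
    rintro ⟨p, ⟨f, g⟩⟩
    -- `η` is the transpose of `g`. The remaining goals say that pushing `f` along `η` gives the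
    -- lens, and that pulling evaluation back along `η` gives `g`.
    let η : p ⟶ homProfunctor b t := discreteProfHom fun n k v (y : b n) =>
      (g.app ⟨k⟩ (act.mk ⟨n⟩ y v) : t k)
    refine Eq.trans (congrArg (CopresheafOptic.mk _ · _) ?_)
      ((CopresheafOptic.mk_eq_of_hom η f _).symm.trans (congrArg (CopresheafOptic.mk p f) ?_))
    · ext ⟨k⟩ x
      change (actDiscreteEquiv (homProfunctor b t) a k).symm (polyLensOfProf p f g k x) =
        ((actMap η).app (Discrete.functor a)).app ⟨k⟩ (f.app ⟨k⟩ x)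
      simp only [polyLensOfProf]
      generalize f.app ⟨k⟩ x = w
      induction w using act.ind with | h n y z
      rfl
    · ext ⟨k⟩ z
      induction z using act.ind with | h n y v
      rfl
  right_inv l := rfl

/-- Polynomial lenses are natural transformations of polynomial functors. -/
def polyHomEquiv (s t : K → Type u) (a b : N → Type u) :
    (poly s t ⟶ poly a b) ≃ PolyLens s t a b where
  toFun τ k x := τ.app (t k) ⟨k, x, id⟩
  invFun l :=
    { app := fun y => TypeCat.ofHom fun z =>
        ⟨(l z.1 z.2.1).1, (l z.1 z.2.1).2.1, fun r => z.2.2 ((l z.1 z.2.1).2.2 r)⟩ }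
  left_inv τ := by
    ext y ⟨k, x, h⟩
    -- Yoneda: `⟨k, x, h⟩` is the image of `⟨k, x, id⟩` under `h : t_k → y`.
    exact (NatTrans.naturality_apply τ (TypeCat.ofHom h) ⟨k, x, id⟩).symm
  right_inv l := rfl

end Discrete

end CompoundOptics

open CompoundOptics in
theorem mainTheorem1 :
    ∃ E : CompoundOptics.PseudofunctorOn CompoundOptics.copresheafAction.{u},
      -- composition is preserved by Fubini
      (∀ (N K L : CompoundOptics.Prof.{u}) (p : N ⟶ K) (q : K ⟶ L) (a : N ⥤ Type u) (l : L)
        (n : N) (k : K) (x : a.obj n) (y : (p.obj (op n)).obj k) (z : (q.obj (op k)).obj l),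
        ((E.mapComp p q).hom.toNatTrans.app a).app l
            (CompoundOptics.act.mk n x (CompoundOptics.act.mk k y z)) =
          CompoundOptics.act.mk k (CompoundOptics.act.mk n x y) z) ∧
      -- units are preserved by co-Yoneda
      (∀ (N : CompoundOptics.Prof.{u}) (a : N ⥤ Type u) (n k : N) (x : a.obj n) (f : n ⟶ k),
        ((E.mapId N).hom.toNatTrans.app a).app k (CompoundOptics.act.mk n x f) = a.map f x) ∧
      -- the compound optic, with this pseudofunctor used twice
      (∀ (N K : CompoundOptics.Prof.{u}) (a b : N ⥤ Type u) (s t : K ⥤ Type u),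
        ∃ e : CompoundOptics.CopresheafOptic a b s t ≃
            CompoundOptics.CompoundOptic E.toPseudofunctor E.toPseudofunctor (i := N) (j := K)
              a b s t,
          ∀ (p : N ⟶ K) (f : s ⟶ (CompoundOptics.act p).obj a)
            (g : (CompoundOptics.act p).obj b ⟶ t),
            e (CompoundOptics.CopresheafOptic.mk p f g) =
              CompoundOptics.CompoundOptic.mk E.toPseudofunctor E.toPseudofunctor p f g) ∧
      -- the discrete case
      (∀ (N K : Type u) (a b : N → Type u) (s t : K → Type u),
        -- sets of natural transformations are products
        (∀ X Y : Discrete K ⥤ Type u,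
          Function.Bijective fun (f : X ⟶ Y) (k : K) (x : X.obj ⟨k⟩) => f.app ⟨k⟩ x) ∧
        -- the internal coends are coproducts
        (∃ φ : ∀ (p : (Discrete N)ᵒᵖ ⥤ Discrete K ⥤ Type u) (r : N → Type u) (k : K),
            ((CompoundOptics.act p).obj (Discrete.functor r)).obj ⟨k⟩ ≃
              Σ n, r n × (p.obj (op ⟨n⟩)).obj ⟨k⟩,
          (∀ p r k n x y, φ p r k (CompoundOptics.act.mk ⟨n⟩ x y) = ⟨n, x, y⟩) ∧
          -- the compound optic is the ommatidia coend
          ∃ θ : CompoundOptics.CompoundOptic E.toPseudofunctor E.toPseudofunctor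
              (i := CompoundOptics.Prof.of (Discrete N)) (j := CompoundOptics.Prof.of (Discrete K))
              (Discrete.functor a) (Discrete.functor b) (Discrete.functor s)
              (Discrete.functor t) ≃ CompoundOptics.Ommatidia s t a b,
            ∀ (p : CompoundOptics.Prof.of (Discrete N) ⟶ CompoundOptics.Prof.of (Discrete K))
              (f : Discrete.functor s ⟶ (CompoundOptics.act p).obj (Discrete.functor a))
              (g : (CompoundOptics.act p).obj (Discrete.functor b) ⟶ Discrete.functor t),
              θ (CompoundOptics.CompoundOptic.mk E.toPseudofunctor E.toPseudofunctor p f g) =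
                CompoundOptics.Ommatidia.mk (fun n k => (p.obj (op ⟨n⟩)).obj ⟨k⟩)
                  (fun k x => φ p a k (f.app ⟨k⟩ x))
                  (fun k z => g.app ⟨k⟩ ((φ p b k).symm z))) ∧
        -- the ommatidia coend is the set of polynomial lenses
        (∃ ψ : CompoundOptics.Ommatidia s t a b ≃ CompoundOptics.PolyLens s t a b,
          ∀ c f g, ψ (CompoundOptics.Ommatidia.mk c f g) = fun k x =>
            ⟨(f k x).1, (f k x).2.1, fun y => g k ⟨(f k x).1, y, (f k x).2.2⟩⟩) ∧
        -- polynomial lenses are natural transformations of polynomial functors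
        ∃ χ : (CompoundOptics.poly s t ⟶ CompoundOptics.poly a b) ≃
            CompoundOptics.PolyLens s t a b,
          ∀ τ k x, χ τ k x = τ.app (t k) ⟨k, x, id⟩) := by
  refine ⟨copresheafPseudofunctor, fun _ _ _ _ _ _ _ _ _ _ _ _ => rfl, fun _ _ _ _ _ _ => rfl,
    exists_copresheafOptic_equiv, fun N K a b s t => ⟨bijective_discrete_natTrans_app,
      ⟨actDiscreteEquiv, fun _ _ _ _ _ _ => rfl, ?_⟩,
      ⟨ommatidiaEquiv s t a b, fun _ _ _ => rfl⟩, polyHomEquiv s t a b, fun _ _ _ => rfl⟩⟩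
  obtain ⟨e, he⟩ := exists_copresheafOptic_equiv (Prof.of (Discrete N)) (Prof.of (Discrete K))
    (Discrete.functor a) (Discrete.functor b) (Discrete.functor s) (Discrete.functor t)
  -- Passing through lenses avoids comparing profunctors on discrete categories with families of
  -- sets directly.
  refine ⟨e.symm.trans ((copresheafOpticEquivPolyLens s t a b).trans (ommatidiaEquiv s t a b).symm),
    fun p f g => ?_⟩
  -- Moving `ommatidiaEquiv` to the other side turns the claim into an equality of lenses, which
  -- holds by computation.
  rw [← he p f g, Equiv.trans_apply, Equiv.symm_apply_apply, Equiv.trans_apply,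
    Equiv.symm_apply_eq]
  rfl
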